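/- Theorem (outer bound for the $(m,3)$ TDBC protocol). Consider a network with terminal nodes $\mathsf a,\mathsf b$ and a set $\mathcal R=\{\mathsf r_1,\dots,\mathsf r_m\}$ of $m$ relays. Each node $i$ has a finite non-empty input alphabet $\mathcal X_i$ and a finite output alphabet $\mathcal Y_i$, both extended by a dummy symbol $\varnothing$ (no input, no output). The channel is memoryless, with a law $p(y\mid x)$ for the inputs and outputs of all nodes in one channel use, and half-duplex: in every channel use each node has input $\varnothing$ or output $\varnothing$. In the $(m,3)$ TDBC protocol a block of $n$ channel uses consists of three successive phases of lengths $n_1+n_2+n_3=n$. In phase 1 only $\mathsf a$ transmits, in phase 2 only $\mathsf b$, and in phase 3 exactly the relays transmit; a transmitting node $i$ uses symbols of $\mathcal X_i$ and all other nodes have input $\varnothing$. Independent messages $W_{\mathsf a}$ (from $\mathsf a$ to $\mathsf b$) and $W_{\mathsf b}$ (from $\mathsf b$ to $\mathsf a$) are uniform on sets of $\lfloor 2^{nR_{\mathsf a}}\rfloor$ and $\lfloor 2^{nR_{\mathsf b}}\rfloor$ elements. The input of a node at time $k$ is a function of its own message (relays have none) and of its outputs at the times $1,\dots,k-1$; at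 the end of the block $\mathsf a$ decodes $W_{\mathsf b}$ from $W_{\mathsf a}$ and all its outputs, and $\mathsf b$ decodes $W_{\mathsf a}$ from $W_{\mathsf b}$ and all its outputs. For fixed $\Delta_1,\Delta_2,\Delta_3\ge 0$ with $\Delta_1+\Delta_2+\Delta_3=1$, a pair $(R_{\mathsf a},R_{\mathsf b})$ of non-negative rates is achievable if there are codes of all block lengths $n$ for which both error probabilities tend to $0$ and $n_\ell/n\to\Delta_\ell$ for $\ell=1,2,3$ as $n\to\infty$. The capacity region is the closure of the set of achievable rate pairs. Then for every pair $(R_{\mathsf a},R_{\mathsf b})$ in the capacity region there are input distributions $p^{(1)}(x_{\mathsf a})$ on $\mathcal X_{\mathsf a}$, $p^{(2)}(x_{\mathsf b})$ on $\mathcal X_{\mathsf b}$ and $p^{(3)}(x_{\mathcal R})$ on $\prod_{r\in\mathcal R}\mathcal X_r$ such that, for all $S_R\subseteq\mathcal R$, with $\bar S_R=\mathcal R\setminus S_R$, $$R_{\mathsf a}\le \Delta_1 I\big(X_{\mathsf a}^{(1)};Y_{\bar S_R}^{(1)},Y_{\mathsf b}^{(1)}\big)+\Delta_3 I\big(X_{S_R}^{(3)};Y_{\mathsf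 b}^{(3)}\,\big|\,X_{\bar S_R}^{(3)}\big),$$ $$R_{\mathsf b}\le \Delta_2 I\big(X_{\mathsf b}^{(2)};Y_{\bar S_R}^{(2)},Y_{\mathsf a}^{(2)}\big)+\Delta_3 I\big(X_{S_R}^{(3)};Y_{\mathsf a}^{(3)}\,\big|\,X_{\bar S_R}^{(3)}\big).$$ Here the (conditional) mutual informations are in bits, and for phase $\ell$ the joint law of inputs and outputs is that of inputs with distribution $p^{(\ell)}$ (the non-transmitting nodes having input $\varnothing$) sent through the channel. -/

import Mathlib

namespace BidirectionalRelay

noncomputable section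

/-! ### Entropy and mutual information of finite random variables, in bits -/

section Information

variable {Ω α β γ : Type*} [Fintype Ω] [Fintype α] [Fintype β] [Fintype γ]

open Classical in
/-- The mass function of the random variable `U` when the sample point `ω` has mass `p ω`. -/
def marginal (p : Ω → ℝ) (U : Ω → α) (u : α) : ℝ :=
  ∑ ω with U ω = u, p ω

/-- Shannon entropy `H(U)` in bits. -/
def entropy (p : Ω → ℝ) (U : Ω → α) : ℝ :=
  (∑ u, Real.negMulLog (marginal p U u)) / Real.log 2

/-- Conditional entropy `H(U | Z) = H(U, Z) - H(Z)`. -/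
def condEntropy (p : Ω → ℝ) (U : Ω → α) (Z : Ω → γ) : ℝ :=
  entropy p (fun ω => (U ω, Z ω)) - entropy p Z

/-- Mutual information `I(U ; V) = H(U) - H(U | V)`. -/
def mutualInfo (p : Ω → ℝ) (U : Ω → α) (V : Ω → β) : ℝ :=
  entropy p U - condEntropy p U V

/-- Conditional mutual information `I(U ; V | Z) = H(U | Z) - H(U | V, Z)`. -/
def condMutualInfo (p : Ω → ℝ) (U : Ω → α) (V : Ω → β) (Z : Ω → γ) : ℝ :=
  condEntropy p U Z - condEntropy p U (fun ω => (V ω, Z ω))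

end Information

/-! ### The network -/

/-- The nodes: the two terminals `a` and `b`, and `m` relays. -/
inductive Node (m : ℕ) : Type
  | a : Node m
  | b : Node m
  | relay : Fin m → Node m
  deriving DecidableEq, Fintype

/-- The set of all relays. -/
def relays (m : ℕ) : Finset (Node m) := Finset.univ.image Node.relay

/-- The channel inputs of all nodes in one channel use; `none` is the dummy symbol of a node that
does not transmit. -/
abbrev Inputs {m : ℕ} (X : Node m → Type*) := ∀ i, Option (X i)

/-- The channel outputs at all nodes in one channel use; `none` is the dummy symbol of a node that
does not receive. -/
abbrev Outputs {m : ℕ} (Y : Node m → Type*) := ∀ i, Option (Y i)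

/-- A discrete half-duplex channel: `law x y` is the probability of the outputs `y` given the
inputs `x`, and in every channel use each node has a dummy input or a dummy output. -/
structure Channel {m : ℕ} (X Y : Node m → Type*) [∀ i, Fintype (Y i)] where
  law : Inputs X → Outputs Y → ℝ
  law_mem : ∀ x, law x ∈ stdSimplex ℝ (Outputs Y)
  half_duplex : ∀ x y i, law x y ≠ 0 → x i = none ∨ y i = none

/-! ### The three-phase TDBC protocol

The phases 1, 2, 3 are numbered `0`, `1`, `2` in the code. -/

/-- The transmitting nodes of each phase: `a` in phase 1, `b` in phase 2, all relays in phase 3. -/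
def transmitters (m : ℕ) : Fin 3 → Finset (Node m) :=
  ![{Node.a}, {Node.b}, relays m]

/-- The phase of the channel use `k`, when the three phases follow each other and
phase `ℓ` has `len ℓ` channel uses. -/
def phaseAt (len : Fin 3 → ℕ) (k : ℕ) : Fin 3 :=
  if k < len 0 then 0 else if k < len 0 + len 1 then 1 else 2

/-- The message set of each node, when `a` has `Ma` messages and `b` has `Mb` messages.
Relays have no message of their own. -/
def Message {m : ℕ} (Ma Mb : ℕ) : Node m → Type
  | .a => Fin Ma
  | .b => Fin Mb
  | .relay _ => Unit

/-- The messages of all nodes. -/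
def messages {m : ℕ} {Ma Mb : ℕ} (wa : Fin Ma) (wb : Fin Mb) : ∀ i : Node m, Message Ma Mb i
  | .a => wa
  | .b => wb
  | .relay _ => ()

/-- A code of block length `n` for the protocol. The encoder of node `i` at time `k` sees the
message of `i` and the outputs at `i` at the times before `k`; it is used only if `i` transmits at
time `k`. The decoders at `a` and `b` return a message or `none` (an error). -/
structure Code {m : ℕ} (X Y : Node m → Type*) (n Ma Mb : ℕ) where
  len : Fin 3 → ℕ
  len_sum : ∑ ℓ, len ℓ = n
  enc : ∀ (i : Node m) (k : Fin n), Message Ma Mb i → (Fin k → Option (Y i)) → X i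
  decA : (Fin n → Option (Y Node.a)) → Fin Ma → Option (Fin Mb)
  decB : (Fin n → Option (Y Node.b)) → Fin Mb → Option (Fin Ma)

section Coding

variable {m : ℕ} {X Y : Node m → Type*} {n Ma Mb : ℕ}

/-- The channel inputs at time `k`, given the messages and the outputs `y` (of which only those
before time `k` are used). -/
def Code.input (c : Code X Y n Ma Mb) (wa : Fin Ma) (wb : Fin Mb) (y : Fin n → Outputs Y)
    (k : Fin n) : Inputs X := fun i =>
  if i ∈ transmitters m (phaseAt c.len k) then
    some (c.enc i k (messages wa wb i) fun j => y ⟨j, j.2.trans k.2⟩ i)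
  else none

variable [∀ i, Fintype (Y i)]

/-- The joint probability of the messages `wa`, `wb` (independent and uniform) and of the outputs
`y` at all nodes during the block, over the memoryless channel `ch`. -/
def Code.prob (c : Code X Y n Ma Mb) (ch : Channel X Y)
    (wa : Fin Ma) (wb : Fin Mb) (y : Fin n → Outputs Y) : ℝ :=
  (Ma : ℝ)⁻¹ * (Mb : ℝ)⁻¹ * ∏ k, ch.law (c.input wa wb y k) (y k)

open Classical in
/-- The probability that `b` does not recover the message of `a`. -/
def Code.errorAB (c : Code X Y n Ma Mb) (ch : Channel X Y) : ℝ :=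
  ∑ wa, ∑ wb, ∑ y : Fin n → Outputs Y,
    if c.decB (fun k => y k Node.b) wb = some wa then 0 else c.prob ch wa wb y

open Classical in
/-- The probability that `a` does not recover the message of `b`. -/
def Code.errorBA (c : Code X Y n Ma Mb) (ch : Channel X Y) : ℝ :=
  ∑ wa, ∑ wb, ∑ y : Fin n → Outputs Y,
    if c.decA (fun k => y k Node.a) wa = some wb then 0 else c.prob ch wa wb y

/-- The number `⌊2 ^ (n R)⌋` of messages at rate `R` and block length `n`. -/
def numMessages (n : ℕ) (R : ℝ) : ℕ := ⌊(2 : ℝ) ^ ((n : ℝ) * R)⌋₊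

open Filter Topology in
/-- Achievability of the rate pair `(Ra, Rb)` with relative phase durations `Δ`. -/
def Achievable (ch : Channel X Y) (Δ : Fin 3 → ℝ) (Ra Rb : ℝ) : Prop :=
  0 ≤ Ra ∧ 0 ≤ Rb ∧
    ∃ c : ∀ n : ℕ, Code X Y n (numMessages n Ra) (numMessages n Rb),
      (∀ ℓ, Tendsto (fun n : ℕ => ((c n).len ℓ : ℝ) / (n : ℝ)) atTop (𝓝 (Δ ℓ))) ∧
      Tendsto (fun n => (c n).errorAB ch) atTop (𝓝 0) ∧
      Tendsto (fun n => (c n).errorBA ch) atTop (𝓝 0)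

/-- The capacity region: the closure of the set of achievable rate pairs. -/
def capacityRegion (ch : Channel X Y) (Δ : Fin 3 → ℝ) : Set (ℝ × ℝ) :=
  closure {R | Achievable ch Δ R.1 R.2}

end Coding

/-! ### The outer bound -/

section OuterBound

variable {m : ℕ} {X Y : Node m → Type*} [∀ i, Fintype (X i)] [∀ i, Fintype (Y i)]

/-- The input distributions of phase `ℓ`: the transmitters of the phase use their non-dummy
alphabets (with an arbitrary joint distribution) and all other inputs are the dummy symbol. -/
def inputDistributions (X : Node m → Type*) [∀ i, Fintype (X i)] (ℓ : Fin 3) :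
    Set (Inputs X → ℝ) :=
  {q | q ∈ stdSimplex ℝ (Inputs X) ∧
    ∀ x, q x ≠ 0 → ∀ i, i ∈ transmitters m ℓ ↔ x i ≠ none}

/-- The joint mass function of inputs and outputs for the input distribution `q`. -/
def jointLaw (ch : Channel X Y) (q : Inputs X → ℝ) : Inputs X × Outputs Y → ℝ :=
  fun ω => q ω.1 * ch.law ω.1 ω.2

/-- The inputs of the nodes in `T`, as a random variable. -/
def inputsOf (X Y : Node m → Type*) (T : Finset (Node m)) (ω : Inputs X × Outputs Y) :
    ∀ i : T, Option (X i) := fun i => ω.1 i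

/-- The outputs at the nodes in `T`, as a random variable. -/
def outputsOf (X Y : Node m → Type*) (T : Finset (Node m)) (ω : Inputs X × Outputs Y) :
    ∀ i : T, Option (Y i) := fun i => ω.2 i

/-- The set of rate pairs that satisfy the cut-set inequalities for some choice of the input
distributions `q ℓ` of the three phases and all sets `S` of relays. -/
def outerRegion (ch : Channel X Y) (Δ : Fin 3 → ℝ) : Set (ℝ × ℝ) :=
  {R | ∃ q : Fin 3 → Inputs X → ℝ, (∀ ℓ, q ℓ ∈ inputDistributions X ℓ) ∧
    ∀ S ⊆ relays m,
      R.1 ≤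
        Δ 0 * mutualInfo (jointLaw ch (q 0)) (inputsOf X Y {Node.a})
            (outputsOf X Y ((relays m \ S) ∪ {Node.b})) +
        Δ 2 * condMutualInfo (jointLaw ch (q 2)) (inputsOf X Y S)
            (outputsOf X Y {Node.b}) (inputsOf X Y (relays m \ S)) ∧
      R.2 ≤
        Δ 1 * mutualInfo (jointLaw ch (q 1)) (inputsOf X Y {Node.b})
            (outputsOf X Y ((relays m \ S) ∪ {Node.a})) +
        Δ 2 * condMutualInfo (jointLaw ch (q 2)) (inputsOf X Y S)
            (outputsOf X Y {Node.a}) (inputsOf X Y (relays m \ S))}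

end OuterBound

end

end BidirectionalRelay

namespace BidirectionalRelay

noncomputable section

open scoped Classical

set_option linter.unusedSectionVars false

/-! ### Entropy as an expectation, and Gibbs' inequality -/

section Entropy

variable {Ω α β : Type*} [Fintype Ω] {p : Ω → ℝ}

/-! This is a cut-set converse. Fix a set T of nodes that contains the decoding terminal but not the
other one. Gibbs' inequality, applied once to the whole block, replaces Fano's inequality and the
entropy chain rule. The density used is the product over time of the single-letter densities p(y_T |
x) / p(y_T | x_T), times 2/|M| where decoding succeeds and 2 where it fails. Dividing the channel by
the single-letter densities leaves outputs on T dominated by kernels that ignore the sender's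
message, so the decoder can only guess (`sum_div_le_one`) and the reference mass is at most one.
Expanding the logarithm gives `log_card_le`.

Within a phase the densities come from the input law q averaged over that phase. They are thus the
same at all times of the phase, so the expected log-density is linear in the input law at time k and
the sum over the phase is exactly its length times the information at q. No concavity and no
time-sharing variable are needed. As q depends only on the code, one choice serves all cuts and both
directions (`Code.exists_cutInfo_bound`).

Half-duplex operation and the silence of non-transmitters then turn `cutInfo` into the informations
of the outer bound, phase by phase. The limit rests on compactness of the input distributions: the
outer region is closed jointly in rates and durations (`isClosed_setOf_mem_outerRegion`). -/

lemma marginal_nonneg (hp : ∀ ω, 0 ≤ p ω) (U : Ω → α) (u : α) : 0 ≤ marginal p U u :=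
  Finset.sum_nonneg fun ω _ => hp ω

lemma le_marginal (hp : ∀ ω, 0 ≤ p ω) (U : Ω → α) (ω : Ω) : p ω ≤ marginal p U (U ω) :=
  Finset.single_le_sum (f := p) (fun i _ => hp i) (by simp)

lemma sum_marginal_mul [Fintype α] (p : Ω → ℝ) (U : Ω → α) (f : α → ℝ) :
    ∑ u, marginal p U u * f u = ∑ ω, p ω * f (U ω) := by
  simp only [marginal, Finset.sum_mul]
  rw [← Finset.sum_fiberwise Finset.univ U (fun ω => p ω * f (U ω))]
  refine Finset.sum_congr rfl fun u _ => Finset.sum_congr rfl fun ω hω => ?_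
  rw [(Finset.mem_filter.1 hω).2]

lemma sum_marginal_pair [Fintype β] (p : Ω → ℝ) (U : Ω → α) (V : Ω → β) (u : α) :
    ∑ v, marginal p (fun ω => (V ω, U ω)) (v, u) = marginal p U u := by
  simp only [marginal, Prod.mk.injEq]
  rw [← Finset.sum_fiberwise (Finset.univ.filter fun ω => U ω = u) V]
  refine Finset.sum_congr rfl fun v _ => ?_
  rw [Finset.filter_filter]
  refine Finset.sum_congr ?_ fun _ _ => rfl
  ext ω
  simp [and_comm]

/-- The entropy is the expectation of the negative logarithm of the mass. -/
lemma entropy_mul_log_two [Fintype α] (p : Ω → ℝ) (U : Ω → α) :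
    entropy p U * Real.log 2 = -∑ ω, p ω * Real.log (marginal p U (U ω)) := by
  have h2 : Real.log 2 ≠ 0 := (Real.log_pos one_lt_two).ne'
  rw [entropy, div_mul_cancel₀ _ h2,
    ← sum_marginal_mul p U (fun u => Real.log (marginal p U u)), ← Finset.sum_neg_distrib]
  exact Finset.sum_congr rfl fun u _ => by rw [Real.negMulLog]; ring

/-- Random variables with the same level sets on the support have the same entropy. -/
lemma entropy_congr [Fintype α] [Fintype β] {U : Ω → α} {V : Ω → β}
    (h : ∀ ω ω', p ω ≠ 0 → p ω' ≠ 0 → (U ω = U ω' ↔ V ω = V ω')) :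
    entropy p U = entropy p V := by
  have h2 : Real.log 2 ≠ 0 := (Real.log_pos one_lt_two).ne'
  refine mul_right_cancel₀ h2 ?_
  rw [entropy_mul_log_two, entropy_mul_log_two]
  congr 1
  refine Finset.sum_congr rfl fun ω _ => ?_
  by_cases hω : p ω = 0
  · simp [hω]
  congr 2
  simp only [marginal, Finset.sum_filter]
  refine Finset.sum_congr rfl fun ω' _ => ?_
  by_cases hω' : p ω' = 0
  · simp [hω']
  · simp only [h ω' ω hω' hω]

/-- Gibbs' inequality for a density `r` with respect to a reference of mass at most one. -/
lemma sum_mul_log_nonneg {r : Ω → ℝ} (hp : ∀ ω, 0 ≤ p ω) (h1 : ∑ ω, p ω = 1)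
    (hr : ∀ ω, p ω ≠ 0 → 0 < r ω) (hs : ∑ ω, p ω / r ω ≤ 1) :
    0 ≤ ∑ ω, p ω * Real.log (r ω) := by
  -- Pointwise log r ≥ 1 - 1/r, weighted by p.
  have : ∑ ω, (p ω - p ω / r ω) ≤ ∑ ω, p ω * Real.log (r ω) := by
    refine Finset.sum_le_sum fun ω _ => ?_
    by_cases hω : p ω = 0
    · simp [hω]
    · have := mul_le_mul_of_nonneg_left (Real.one_sub_inv_le_log_of_pos (hr ω hω)) (hp ω)
      rwa [mul_sub, mul_one, ← div_eq_mul_inv] at this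
  rw [Finset.sum_sub_distrib, h1] at this
  linarith

end Entropy

/-! ### Products of causal kernels (channels with feedback) -/

section Sequential

variable {α β : Type*}

/-- The entries of `y` before `k`. -/
def past {n : ℕ} (y : Fin n → α) (k : Fin n) : Fin k → α := fun j => y ⟨j, j.2.trans k.2⟩

lemma past_snoc_castSucc {n : ℕ} (y : Fin n → α) (v : α) (k : Fin n) :
    past (Fin.snoc y v : Fin (n + 1) → α) k.castSucc = past y k := by
  funext j
  exact Fin.snoc_castSucc (α := fun _ => α) v y ⟨j, j.2.trans k.2⟩

lemma past_snoc_last {n : ℕ} (y : Fin n → α) (v : α) :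
    past (Fin.snoc y v : Fin (n + 1) → α) (Fin.last n) = y := by
  funext j
  exact Fin.snoc_castSucc (α := fun _ => α) v y j

lemma sum_snoc [Fintype α] {n : ℕ} (f : (Fin (n + 1) → α) → ℝ) :
    ∑ y, f y = ∑ y : Fin n → α, ∑ v, f (Fin.snoc y v) := by
  rw [← (Fin.snocEquiv fun _ : Fin (n + 1) => α).sum_comp, Fintype.sum_prod_type,
    Finset.sum_comm]
  rfl

/-- No earlier kernel sees the last symbol, so it can be summed out first. This drives the
inductions on block length. -/
lemma prod_snoc {n : ℕ} (κ : ∀ k : Fin (n + 1), (Fin k → α) → α → ℝ) (y : Fin n → α) (v : α) :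
    ∏ k, κ k (past (Fin.snoc y v : Fin (n + 1) → α) k) ((Fin.snoc y v : Fin (n + 1) → α) k) =
      (∏ k : Fin n, κ k.castSucc (past y k) (y k)) * κ (Fin.last n) y v := by
  rw [Fin.prod_univ_castSucc]
  congr 1
  · refine Finset.prod_congr rfl fun k _ => ?_
    rw [past_snoc_castSucc]
    exact congrArg _ (Fin.snoc_castSucc (α := fun _ => α) v y k)
  · rw [past_snoc_last]
    exact congrArg _ (Fin.snoc_last (α := fun _ => α) v y)

/-- A product of stochastic kernels has total mass one. -/
lemma sum_prod_kernel [Fintype α] {n : ℕ} (κ : ∀ k : Fin n, (Fin k → α) → α → ℝ)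
    (h : ∀ k s, ∑ v, κ k s v = 1) : ∑ y : Fin n → α, ∏ k, κ k (past y k) (y k) = 1 := by
  induction n with
  | zero => simp
  | succ n ih =>
    simp only [sum_snoc, prod_snoc, ← Finset.mul_sum, h, mul_one]
    exact ih (fun k => κ k.castSucc) fun k => h k.castSucc

/-- The conditional expectation of a function of the outputs up to time `k`, given the past. -/
lemma sum_prod_kernel_mul [Fintype α] {n : ℕ} (κ : ∀ k : Fin n, (Fin k → α) → α → ℝ)
    (h : ∀ k s, ∑ v, κ k s v = 1) (k : Fin n) (f : (Fin k → α) → α → ℝ) :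
    ∑ y : Fin n → α, (∏ j, κ j (past y j) (y j)) * f (past y k) (y k) =
      ∑ y : Fin n → α, (∏ j, κ j (past y j) (y j)) *
        ∑ v, κ k (past y k) v * f (past y k) v := by
  induction n with
  | zero => exact k.elim0
  | succ n ih =>
    simp only [sum_snoc, prod_snoc]
    induction k using Fin.lastCases with
    | last =>
      simp only [past_snoc_last, Fin.snoc_last]
      refine Finset.sum_congr rfl fun y _ => ?_
      rw [← Finset.sum_mul, ← Finset.mul_sum, h, mul_one, Finset.mul_sum]
      exact Finset.sum_congr rfl fun v _ => by ring
    | cast k =>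
      simp only [past_snoc_castSucc, Fin.snoc_castSucc]
      -- The function does not involve the last symbol, so the last kernel sums to one on both
      -- sides.
      simp only [mul_right_comm _ (κ (Fin.last n) _ _), ← Finset.mul_sum, h, mul_one]
      exact ih (fun k => κ k.castSucc) (fun k => h k.castSucc) k f

/-- Bound for the mass that a product of kernels gives to a fibre of a coordinatewise map. -/
lemma sum_fiber_prod_kernel_le [Fintype α] {n : ℕ} (π : α → β) (κ : ∀ k : Fin n, (Fin k → α) → α → ℝ)
    (μ : ∀ k : Fin n, (Fin k → β) → β → ℝ) (hκ : ∀ k s v, 0 ≤ κ k s v)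
    (hμ : ∀ k s t, 0 ≤ μ k s t)
    (h : ∀ k s t, ∑ v with π v = t, κ k s v ≤ μ k (π ∘ s) t) (z : Fin n → β) :
    ∑ y : Fin n → α with π ∘ y = z, ∏ k, κ k (past y k) (y k) ≤
      ∏ k, μ k (past z k) (z k) := by
  induction n with
  | zero => simp [Subsingleton.elim _ z]
  | succ n ih =>
    obtain ⟨z', t, rfl⟩ : ∃ (z' : Fin n → β) (t : β), z = Fin.snoc z' t :=
      ⟨Fin.init z, z (Fin.last n), (Fin.snoc_init_self z).symm⟩
    have hiff : ∀ (y : Fin n → α) (v : α),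
        π ∘ (Fin.snoc y v : Fin (n + 1) → α) = Fin.snoc z' t ↔ π ∘ y = z' ∧ π v = t := by
      intro y v
      rw [Fin.comp_snoc]
      exact Fin.snoc_inj
    rw [prod_snoc, Finset.sum_filter, sum_snoc]
    simp only [hiff, prod_snoc]
    have step : ∀ y : Fin n → α, (∑ v, if π ∘ y = z' ∧ π v = t then
        (∏ k : Fin n, κ k.castSucc (past y k) (y k)) * κ (Fin.last n) y v else 0) ≤
        if π ∘ y = z' then (∏ k : Fin n, κ k.castSucc (past y k) (y k)) *
          μ (Fin.last n) z' t else 0 := by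
      intro y
      by_cases hy : π ∘ y = z'
      · simp only [hy, true_and, if_true]
        rw [← Finset.sum_filter, ← Finset.mul_sum]
        refine mul_le_mul_of_nonneg_left ?_ (Finset.prod_nonneg fun k _ => hκ _ _ _)
        rw [← hy]
        exact h (Fin.last n) y t
      · simp [hy]
    refine (Finset.sum_le_sum fun y _ => step y).trans ?_
    rw [← Finset.sum_filter, ← Finset.sum_mul]
    exact mul_le_mul_of_nonneg_right
      (ih (fun k => κ k.castSucc) (fun k => μ k.castSucc) (fun k => hκ k.castSucc)
        (fun k => hμ k.castSucc) (fun k => h k.castSucc) z') (hμ (Fin.last n) z' t)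

end Sequential

/-! ### The converse for a single cut, by change of measure -/

section SingleCut

variable {A B A' B' M N : Type*} [Fintype A] [Fintype B] [Fintype A'] [Fintype B']
  [Fintype M] [Fintype N]

/-- The density `p(v | x) / p(v | u)` of an output `v` given the input `x` relative to a function
`u` of the input. -/
def infoDensity (p : A × B → ℝ) (U : A → A') (V : B → B') (ω : A × B) : ℝ :=
  marginal p (fun ω => (V ω.2, ω.1)) (V ω.2, ω.1) * marginal p (fun ω => U ω.1) (U ω.1) /
    (marginal p (fun ω => (V ω.2, U ω.1)) (V ω.2, U ω.1) * marginal p (fun ω => ω.1) ω.1)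

lemma infoDensity_pos {p : A × B → ℝ} (hp : ∀ ω, 0 ≤ p ω) (U : A → A') (V : B → B') {ω : A × B}
    (hω : p ω ≠ 0) : 0 < infoDensity p U V ω := by
  have h0 : 0 < p ω := (hp ω).lt_of_ne' hω
  have h1 := h0.trans_le (le_marginal hp (fun ω => (V ω.2, ω.1)) ω)
  have h2 := h0.trans_le (le_marginal hp (fun ω => U ω.1) ω)
  have h3 := h0.trans_le (le_marginal hp (fun ω => (V ω.2, U ω.1)) ω)
  have h4 := h0.trans_le (le_marginal hp (fun ω => ω.1) ω)
  unfold infoDensity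
  positivity

lemma sum_mul_log_infoDensity {p : A × B → ℝ} (hp : ∀ ω, 0 ≤ p ω) (U : A → A') (V : B → B') :
    ∑ ω, p ω * Real.log (infoDensity p U V ω) =
      (condEntropy p (fun ω => V ω.2) (fun ω => U ω.1) -
        condEntropy p (fun ω => V ω.2) (fun ω => ω.1)) * Real.log 2 := by
  simp only [condEntropy, sub_mul, entropy_mul_log_two]
  simp only [← Finset.sum_neg_distrib, ← Finset.sum_sub_distrib]
  refine Finset.sum_congr rfl fun ω _ => ?_
  by_cases hω : p ω = 0
  · simp [hω]
  have h0 : 0 < p ω := (hp ω).lt_of_ne' hω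
  have h1 := (h0.trans_le (le_marginal hp (fun ω => (V ω.2, ω.1)) ω)).ne'
  have h2 := (h0.trans_le (le_marginal hp (fun ω => U ω.1) ω)).ne'
  have h3 := (h0.trans_le (le_marginal hp (fun ω => (V ω.2, U ω.1)) ω)).ne'
  have h4 := (h0.trans_le (le_marginal hp (fun ω => ω.1) ω)).ne'
  rw [infoDensity, Real.log_div (mul_ne_zero h1 h2) (mul_ne_zero h3 h4), Real.log_mul h1 h2,
    Real.log_mul h3 h4]
  ring

/-- The conditional mass of an output given a function of the input. -/
def condMass (p : A × B → ℝ) (U : A → A') (V : B → B') (u : A') (t : B') : ℝ :=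
  marginal p (fun ω => (V ω.2, U ω.1)) (t, u) / marginal p (fun ω => U ω.1) u

lemma condMass_nonneg {p : A × B → ℝ} (hp : ∀ ω, 0 ≤ p ω) (U : A → A') (V : B → B') (u : A')
    (t : B') : 0 ≤ condMass p U V u t :=
  div_nonneg (marginal_nonneg hp _ _) (marginal_nonneg hp _ _)

/-- Only an inequality, since at a value `u` of mass zero the quotients are all zero. -/
lemma sum_condMass_le_one (p : A × B → ℝ) (U : A → A') (V : B → B') (u : A') :
    ∑ t, condMass p U V u t ≤ 1 := by
  simp only [condMass]
  rw [← Finset.sum_div, sum_marginal_pair p (fun ω => U ω.1) (fun ω => V ω.2) u]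
  exact div_self_le_one _

lemma marginal_output_input (q : A → ℝ) (W : A → B → ℝ) (V : B → B') (t : B') (x : A) :
    marginal (fun ω : A × B => q ω.1 * W ω.1 ω.2) (fun ω => (V ω.2, ω.1)) (t, x) =
      q x * ∑ v with V v = t, W x v := by
  rw [marginal, Finset.sum_filter, Fintype.sum_prod_type, Finset.sum_eq_single x]
  · rw [Finset.mul_sum, Finset.sum_filter]
    exact Finset.sum_congr rfl fun v _ => by simp
  · intro x' _ hx'
    simp [hx']
  · simp

lemma marginal_input (q : A → ℝ) (W : A → B → ℝ) (hW1 : ∀ x, ∑ v, W x v = 1) (x : A) :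
    marginal (fun ω : A × B => q ω.1 * W ω.1 ω.2) (fun ω => ω.1) x = q x := by
  rw [marginal, Finset.sum_filter, Fintype.sum_prod_type, Finset.sum_eq_single x]
  · simp [← Finset.mul_sum, hW1]
  · intro x' _ hx'
    simp [hx']
  · simp

/-- The density depends on `v` only through `V v`, so on a fibre it cancels p(t | x) and leaves p(t
| u), which sees the input only through `U`. Where `q x` or the fibre mass vanishes, the left side
is zero. -/
lemma sum_div_infoDensity_le (q : A → ℝ) (hq : ∀ x, 0 ≤ q x) (W : A → B → ℝ)
    (hW0 : ∀ x v, 0 ≤ W x v) (hW1 : ∀ x, ∑ v, W x v = 1) (U : A → A') (V : B → B')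
    (x : A) (t : B') :
    ∑ v with V v = t, W x v / infoDensity (fun ω : A × B => q ω.1 * W ω.1 ω.2) U V (x, v) ≤
      condMass (fun ω : A × B => q ω.1 * W ω.1 ω.2) U V (U x) t := by
  set p := fun ω : A × B => q ω.1 * W ω.1 ω.2 with hp
  have hp0 : ∀ ω, 0 ≤ p ω := fun ω => mul_nonneg (hq _) (hW0 _ _)
  have hv : ∀ v ∈ Finset.univ.filter (fun v => V v = t), W x v / infoDensity p U V (x, v) =
      W x v / (q x * (∑ v with V v = t, W x v) * marginal p (fun ω => U ω.1) (U x) /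
        (marginal p (fun ω => (V ω.2, U ω.1)) (t, U x) * q x)) := by
    intro v hv
    rw [infoDensity]
    simp only [(Finset.mem_filter.1 hv).2]
    rw [marginal_output_input, marginal_input q W hW1]
  rw [Finset.sum_congr rfl hv, ← Finset.sum_div]
  have hc := condMass_nonneg hp0 U V (U x) t
  by_cases h1 : q x = 0
  · simpa [h1] using hc
  by_cases h2 : ∑ v with V v = t, W x v = 0
  · simpa [h2] using hc
  rw [condMass]
  apply le_of_eq
  by_cases h3 : marginal p (fun ω => U ω.1) (U x) = 0
  · simp [h3]
  · field_simp

variable {n : ℕ}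

/-- The joint law of two independent uniform messages and of the outputs of a channel `W` that is
used with feedback. -/
def feedbackLaw (W : A → B → ℝ) (inp : M → N → ∀ k : Fin n, (Fin k → B) → A)
    (ω : M × N × (Fin n → B)) : ℝ :=
  (Fintype.card M : ℝ)⁻¹ * (Fintype.card N : ℝ)⁻¹ *
    ∏ k, W (inp ω.1 ω.2.1 k (past ω.2.2 k)) (ω.2.2 k)

lemma feedbackLaw_nonneg {W : A → B → ℝ} (hW0 : ∀ x v, 0 ≤ W x v)
    (inp : M → N → ∀ k : Fin n, (Fin k → B) → A) (ω : M × N × (Fin n → B)) :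
    0 ≤ feedbackLaw W inp ω :=
  mul_nonneg (by positivity) (Finset.prod_nonneg fun _ _ => hW0 _ _)

lemma sum_feedbackLaw [Nonempty M] [Nonempty N] {W : A → B → ℝ} (hW1 : ∀ x, ∑ v, W x v = 1)
    (inp : M → N → ∀ k : Fin n, (Fin k → B) → A) : ∑ ω, feedbackLaw W inp ω = 1 := by
  simp only [feedbackLaw, Fintype.sum_prod_type, ← Finset.mul_sum]
  have h : ∀ a b, ∑ y : Fin n → B, ∏ k, W (inp a b k (past y k)) (y k) = 1 := fun a b =>
    sum_prod_kernel (fun k s v => W (inp a b k s) v) fun k s => hW1 _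
  simp only [h, Finset.sum_const, Finset.card_univ, nsmul_eq_mul, mul_one]
  field_simp

/-- Given messages and past, the output at time `k` has law `W` at the current input. Hence the
expectation is linear in the input law at time `k`, which makes averaging over a phase exact. -/
lemma sum_feedbackLaw_mul {W : A → B → ℝ} (hW1 : ∀ x, ∑ v, W x v = 1)
    (inp : M → N → ∀ k : Fin n, (Fin k → B) → A) (k : Fin n) (φ : A × B → ℝ) :
    ∑ ω, feedbackLaw W inp ω * φ (inp ω.1 ω.2.1 k (past ω.2.2 k), ω.2.2 k) =
      ∑ x, marginal (feedbackLaw W inp) (fun ω => inp ω.1 ω.2.1 k (past ω.2.2 k)) x *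
        ∑ v, W x v * φ (x, v) := by
  rw [sum_marginal_mul (feedbackLaw W inp) (fun ω => inp ω.1 ω.2.1 k (past ω.2.2 k))
    (fun x => ∑ v, W x v * φ (x, v))]
  simp only [Fintype.sum_prod_type, feedbackLaw]
  refine Finset.sum_congr rfl fun a _ => Finset.sum_congr rfl fun b _ => ?_
  simp only [mul_assoc, ← Finset.mul_sum]
  rw [sum_prod_kernel_mul (fun k s v => W (inp a b k s) v) (fun k s => hW1 _) k
    fun s v => φ (inp a b k s, v)]

/-- A decoder that does not see the first message, in a system where the outputs do not depend
on that message, is correct with probability at most `1 / |M|`. -/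
lemma sum_div_le_one [Nonempty M] [Nonempty N]
    (κ : M → N → ∀ k : Fin n, (Fin k → B) → B → ℝ) (hκ : ∀ a b k s v, 0 ≤ κ a b k s v)
    (V : B → B') (μ : N → ∀ k : Fin n, (Fin k → B') → B' → ℝ) (hμ : ∀ b k s t, 0 ≤ μ b k s t)
    (hμ1 : ∀ b k s, ∑ t, μ b k s t ≤ 1)
    (h : ∀ a b k s t, ∑ v with V v = t, κ a b k s v ≤ μ b k (V ∘ s) t)
    (dec : (Fin n → B') → N → Option M) :
    ∑ ω : M × N × (Fin n → B), (Fintype.card M : ℝ)⁻¹ * (Fintype.card N : ℝ)⁻¹ *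
        (∏ k, κ ω.1 ω.2.1 k (past ω.2.2 k) (ω.2.2 k)) *
          (if dec (V ∘ ω.2.2) ω.2.1 = some ω.1 then (Fintype.card M : ℝ) / 2 else 1 / 2) ≤ 1 := by
  have hM : (0 : ℝ) < Fintype.card M := by exact_mod_cast Fintype.card_pos
  have hN : (0 : ℝ) < Fintype.card N := by exact_mod_cast Fintype.card_pos
  set g : M → N → (Fin n → B') → ℝ := fun a b z =>
    if dec z b = some a then (Fintype.card M : ℝ) / 2 else 1 / 2 with hg
  have hg0 : ∀ a b z, 0 ≤ g a b z := by
    intro a b z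
    simp only [hg]
    split_ifs <;> positivity
  -- At most one message equals the decoder's answer. It contributes at most |M|/2 beyond the
  -- constant 1/2, which sums to another |M|/2.
  have hgM : ∀ b z, ∑ a, g a b z ≤ Fintype.card M := by
    intro b z
    have h1 : ∀ a, g a b z ≤ (if dec z b = some a then (Fintype.card M : ℝ) / 2 else 0) + 1 / 2 := by
      intro a
      simp only [hg]
      split_ifs <;> linarith
    refine (Finset.sum_le_sum fun a _ => h1 a).trans ?_
    rw [Finset.sum_add_distrib]
    have h2 : ∑ a, (if dec z b = some a then (Fintype.card M : ℝ) / 2 else 0) ≤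
        (Fintype.card M : ℝ) / 2 := by
      cases hd : dec z b with
      | none => simp; positivity
      | some a₀ => simp
    have h3 : ∑ _a : M, (1 / 2 : ℝ) = Fintype.card M / 2 := by simp; ring
    linarith
  have hμs : ∀ b, ∑ z : Fin n → B', ∏ k, μ b k (past z k) (z k) ≤ 1 := by
    intro b
    -- The kernels `μ` are only substochastic; projecting to a one-point space bounds their total
    -- mass by one.
    have := sum_fiber_prod_kernel_le (fun _ : B' => ()) (fun k s t => μ b k s t)
      (fun _ _ _ => 1) (hμ b) (fun _ _ _ => zero_le_one)
      (fun k s t => by simpa using hμ1 b k s) (fun _ => ())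
    rw [Finset.prod_const_one, Finset.sum_filter] at this
    refine le_trans (le_of_eq (Finset.sum_congr rfl fun z _ => ?_)) this
    rw [if_pos (funext fun _ => rfl)]
  have hab : ∀ a b, ∑ y : Fin n → B, (∏ k, κ a b k (past y k) (y k)) * g a b (V ∘ y) ≤
      ∑ z : Fin n → B', g a b z * ∏ k, μ b k (past z k) (z k) := by
    intro a b
    rw [← Finset.sum_fiberwise Finset.univ (fun y : Fin n → B => V ∘ y)]
    refine Finset.sum_le_sum fun z _ => ?_
    have : ∀ y ∈ Finset.univ.filter (fun y : Fin n → B => V ∘ y = z),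
        (∏ k, κ a b k (past y k) (y k)) * g a b (V ∘ y) =
          g a b z * ∏ k, κ a b k (past y k) (y k) := by
      intro y hy
      rw [(Finset.mem_filter.1 hy).2, mul_comm]
    rw [Finset.sum_congr rfl this, ← Finset.mul_sum]
    exact mul_le_mul_of_nonneg_left
      (sum_fiber_prod_kernel_le V (κ a b) (μ b) (hκ a b) (hμ b) (h a b) z) (hg0 a b z)
  have hsum : ∑ a, ∑ b, ∑ y : Fin n → B, (∏ k, κ a b k (past y k) (y k)) * g a b (V ∘ y) ≤
      Fintype.card M * Fintype.card N := by
    refine (Finset.sum_le_sum fun a _ => Finset.sum_le_sum fun b _ => hab a b).trans ?_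
    rw [Finset.sum_comm]
    have : ∀ b, ∑ a, ∑ z : Fin n → B', g a b z * ∏ k, μ b k (past z k) (z k) ≤
        Fintype.card M := by
      intro b
      rw [Finset.sum_comm]
      simp only [← Finset.sum_mul]
      calc _ ≤ ∑ z : Fin n → B', (Fintype.card M : ℝ) * ∏ k, μ b k (past z k) (z k) :=
            Finset.sum_le_sum fun z _ => mul_le_mul_of_nonneg_right (hgM b z)
              (Finset.prod_nonneg fun k _ => hμ b k _ _)
        _ ≤ Fintype.card M := by
            rw [← Finset.mul_sum]
            exact mul_le_of_le_one_right hM.le (hμs b)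
    refine (Finset.sum_le_sum fun b _ => this b).trans (le_of_eq ?_)
    simp [mul_comm]
  simp only [Fintype.sum_prod_type, mul_assoc, ← Finset.mul_sum]
  rw [← mul_assoc, ← mul_inv, inv_mul_le_one₀ (by positivity)]
  exact hsum

/-- The converse for one cut: the bound on the number of messages `M` in terms of the input
distributions `q ℓ` averaged over the channel uses of each phase `ℓ`. -/
theorem log_card_le [Nonempty M] [Nonempty N] {L : Type*} [Fintype L] [DecidableEq L]
    {W : A → B → ℝ}
    (hW0 : ∀ x v, 0 ≤ W x v) (hW1 : ∀ x, ∑ v, W x v = 1)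
    (inp : M → N → ∀ k : Fin n, (Fin k → B) → A) (U : A → A') (V : B → B')
    (uinp : N → ∀ k : Fin n, (Fin k → B') → A')
    (hU : ∀ a b k s, U (inp a b k s) = uinp b k (V ∘ s))
    (dec : (Fin n → B') → N → Option M) (ph : Fin n → L) (len : L → ℝ) (q : L → A → ℝ)
    (hq0 : ∀ ℓ x, 0 ≤ q ℓ x)
    (hq : ∀ ℓ x, len ℓ * q ℓ x = ∑ k with ph k = ℓ,
      marginal (feedbackLaw W inp) (fun ω => inp ω.1 ω.2.1 k (past ω.2.2 k)) x) :
    (1 - ∑ ω, if dec (V ∘ ω.2.2) ω.2.1 = some ω.1 then 0 else feedbackLaw W inp ω) *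
        Real.log (Fintype.card M) - Real.log 2 ≤
      ∑ ℓ, len ℓ * ((condEntropy (fun ω : A × B => q ℓ ω.1 * W ω.1 ω.2) (fun ω => V ω.2)
        (fun ω => U ω.1) - condEntropy (fun ω : A × B => q ℓ ω.1 * W ω.1 ω.2) (fun ω => V ω.2)
        (fun ω => ω.1)) * Real.log 2) := by
  have hM : (0 : ℝ) < Fintype.card M := by exact_mod_cast Fintype.card_pos
  set P := feedbackLaw W inp with hP
  have hP0 : ∀ ω, 0 ≤ P ω := feedbackLaw_nonneg hW0 inp
  have hP1 : ∑ ω, P ω = 1 := sum_feedbackLaw hW1 inp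
  set p : L → A × B → ℝ := fun ℓ ω => q ℓ ω.1 * W ω.1 ω.2 with hp
  have hp0 : ∀ ℓ ω, 0 ≤ p ℓ ω := fun ℓ ω => mul_nonneg (hq0 _ _) (hW0 _ _)
  set x : Fin n → M × N × (Fin n → B) → A := fun k ω => inp ω.1 ω.2.1 k (past ω.2.2 k) with hx
  set ρ : Fin n → M × N × (Fin n → B) → ℝ :=
    fun k ω => infoDensity (p (ph k)) U V (x k ω, ω.2.2 k) with hρ
  -- Under pure guessing the correct outcome has mass at most 1/|M|, so 1/c averages to at most 1/2
  -- + 1/2. The factor 2 costs the `Real.log 2` in the conclusion.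
  set c : M × N × (Fin n → B) → ℝ := fun ω =>
    if dec (V ∘ ω.2.2) ω.2.1 = some ω.1 then 2 / (Fintype.card M : ℝ) else 2 with hc
  have hc0 : ∀ ω, 0 < c ω := by
    intro ω
    simp only [hc]
    split_ifs <;> positivity
  have hρ0 : ∀ ω, P ω ≠ 0 → ∀ k, 0 < ρ k ω := by
    intro ω hω k
    -- An input that occurs with positive probability at time `k` also has positive mass in the
    -- average over the phase of `k`.
    refine infoDensity_pos (hp0 _) U V (mul_ne_zero ?_ ?_)
    · intro h
      have h1 := hq (ph k) (x k ω)
      rw [h, mul_zero] at h1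
      have h2 : P ω ≤ ∑ j with ph j = ph k, marginal P (x j) (x k ω) :=
        (le_marginal hP0 (x k) ω).trans
          (Finset.single_le_sum (f := fun j => marginal P (x j) (x k ω))
            (fun j _ => marginal_nonneg hP0 _ _) (by simp))
      exact hω (le_antisymm (h2.trans h1.symm.le) (hP0 ω))
    · intro h
      apply hω
      rw [hP, feedbackLaw, Finset.prod_eq_zero (Finset.mem_univ k) h, mul_zero]
  have hgibbs := sum_mul_log_nonneg (r := fun ω => (∏ k, ρ k ω) * c ω) hP0 hP1
    (fun ω hω => mul_pos (Finset.prod_pos fun k _ => hρ0 ω hω k) (hc0 ω)) (by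
      refine le_trans (le_of_eq ?_) (sum_div_le_one
        (fun a b k s v => W (inp a b k s) v / infoDensity (p (ph k)) U V (inp a b k s, v))
        (fun a b k s v => div_nonneg (hW0 _ _)
          (div_nonneg (mul_nonneg (marginal_nonneg (hp0 _) _ _) (marginal_nonneg (hp0 _) _ _))
            (mul_nonneg (marginal_nonneg (hp0 _) _ _) (marginal_nonneg (hp0 _) _ _))))
        V (fun b k s t => condMass (p (ph k)) U V (uinp b k s) t)
        (fun b k s t => condMass_nonneg (hp0 _) _ _ _ _)
        (fun b k s => sum_condMass_le_one _ _ _ _)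
        (fun a b k s t => by
          rw [← hU a]
          exact sum_div_infoDensity_le (q (ph k)) (hq0 _) W hW0 hW1 U V _ t) dec)
      refine Finset.sum_congr rfl fun ω _ => ?_
      have hinv : (c ω)⁻¹ = if dec (V ∘ ω.2.2) ω.2.1 = some ω.1
          then (Fintype.card M : ℝ) / 2 else 1 / 2 := by
        simp only [hc]
        split_ifs <;> simp
      rw [← hinv, hP, feedbackLaw, Finset.prod_div_distrib, mul_div_assoc, div_mul_eq_div_div,
        div_eq_mul_inv (_ / _) (c ω), ← mul_assoc])
  have hlog : ∀ ω, P ω * Real.log ((∏ k, ρ k ω) * c ω) =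
      ∑ k, P ω * Real.log (ρ k ω) + P ω * Real.log (c ω) := by
    intro ω
    by_cases hω : P ω = 0
    · simp [hω]
    rw [Real.log_mul (Finset.prod_pos fun k _ => hρ0 ω hω k).ne' (hc0 ω).ne',
      Real.log_prod fun k _ => (hρ0 ω hω k).ne', mul_add, Finset.mul_sum]
  have hcsum : ∑ ω, P ω * Real.log (c ω) = Real.log 2 -
      (1 - ∑ ω, if dec (V ∘ ω.2.2) ω.2.1 = some ω.1 then 0 else P ω) *
        Real.log (Fintype.card M) := by
    have h1 : ∀ ω, P ω * Real.log (c ω) = P ω * Real.log 2 - (P ω -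
        if dec (V ∘ ω.2.2) ω.2.1 = some ω.1 then 0 else P ω) * Real.log (Fintype.card M) := by
      intro ω
      simp only [hc]
      split_ifs
      · rw [Real.log_div two_ne_zero hM.ne']
        ring
      · ring
    simp only [h1, Finset.sum_sub_distrib, ← Finset.sum_mul, hP1, one_mul]
  have hk : ∀ k, ∑ ω, P ω * Real.log (ρ k ω) = ∑ z, marginal P (x k) z *
      ∑ v, W z v * Real.log (infoDensity (p (ph k)) U V (z, v)) := fun k =>
    sum_feedbackLaw_mul hW1 inp k fun ω => Real.log (infoDensity (p (ph k)) U V ω)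
  have hfinal : ∑ k, ∑ ω, P ω * Real.log (ρ k ω) =
      ∑ ℓ, len ℓ * ∑ ω, p ℓ ω * Real.log (infoDensity (p ℓ) U V ω) := by
    simp only [hk]
    -- Group the times by phase: the density is constant within a group, so the input laws add up to
    -- `len ℓ * q ℓ`.
    rw [← Finset.sum_fiberwise Finset.univ ph]
    refine Finset.sum_congr rfl fun ℓ _ => ?_
    have h1 : ∀ k ∈ Finset.univ.filter (fun k => ph k = ℓ), (∑ z, marginal P (x k) z *
        ∑ v, W z v * Real.log (infoDensity (p (ph k)) U V (z, v))) = ∑ z, marginal P (x k) z *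
        ∑ v, W z v * Real.log (infoDensity (p ℓ) U V (z, v)) := by
      intro k hk
      rw [(Finset.mem_filter.1 hk).2]
    rw [Finset.sum_congr rfl h1, Finset.sum_comm, Fintype.sum_prod_type, Finset.mul_sum]
    refine Finset.sum_congr rfl fun z _ => ?_
    rw [← Finset.sum_mul, ← hq ℓ z, mul_assoc, Finset.mul_sum]
    simp only [hp, mul_assoc]
  simp only [hlog, Finset.sum_add_distrib] at hgibbs
  rw [hcsum, Finset.sum_comm, hfinal] at hgibbs
  simp only [sum_mul_log_infoDensity (hp0 _)] at hgibbs
  linarith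

end SingleCut

/-! ### Cut information in each phase -/

section Cuts

variable {m : ℕ} {X Y : Node m → Type*} [∀ i, Fintype (X i)] [∀ i, Fintype (Y i)]

/-- The information `H(Y_T | X_T) - H(Y_T | X)` that flows to the nodes in `T` from the others. -/
def cutInfo (ch : Channel X Y) (q : Inputs X → ℝ) (T : Finset (Node m)) : ℝ :=
  condEntropy (jointLaw ch q) (outputsOf X Y T) (inputsOf X Y T) -
    condEntropy (jointLaw ch q) (outputsOf X Y T) (fun ω => ω.1)

lemma inputsOf_eq_iff (T : Finset (Node m)) (ω ω' : Inputs X × Outputs Y) :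
    inputsOf X Y T ω = inputsOf X Y T ω' ↔ ∀ i ∈ T, ω.1 i = ω'.1 i := by
  simp [funext_iff, inputsOf]

lemma outputsOf_eq_iff (T : Finset (Node m)) (ω ω' : Inputs X × Outputs Y) :
    outputsOf X Y T ω = outputsOf X Y T ω' ↔ ∀ i ∈ T, ω.2 i = ω'.2 i := by
  simp [funext_iff, outputsOf]

lemma sum_jointLaw (ch : Channel X Y) {q : Inputs X → ℝ} (hq : ∑ x, q x = 1) :
    ∑ ω, jointLaw ch q ω = 1 := by
  simp only [jointLaw, Fintype.sum_prod_type, ← Finset.mul_sum, (ch.law_mem _).2, mul_one, hq]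

variable {ch : Channel X Y} {q : Inputs X → ℝ} {ℓ : Fin 3}

lemma input_eq_of_not_mem (hq : q ∈ inputDistributions X ℓ) {ω ω' : Inputs X × Outputs Y}
    (hω : jointLaw ch q ω ≠ 0) (hω' : jointLaw ch q ω' ≠ 0) {i : Node m}
    (hi : i ∉ transmitters m ℓ) : ω.1 i = ω'.1 i := by
  have h := hq.2 ω.1 (left_ne_zero_of_mul hω) i
  have h' := hq.2 ω'.1 (left_ne_zero_of_mul hω') i
  rw [not_not.1 (mt h.2 hi), not_not.1 (mt h'.2 hi)]

lemma output_eq_of_mem (hq : q ∈ inputDistributions X ℓ) {ω ω' : Inputs X × Outputs Y}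
    (hω : jointLaw ch q ω ≠ 0) (hω' : jointLaw ch q ω' ≠ 0) {i : Node m}
    (hi : i ∈ transmitters m ℓ) : ω.2 i = ω'.2 i := by
  have h := (hq.2 ω.1 (left_ne_zero_of_mul hω) i).1 hi
  have h' := (hq.2 ω'.1 (left_ne_zero_of_mul hω') i).1 hi
  rw [(ch.half_duplex _ _ i (right_ne_zero_of_mul hω)).resolve_left h,
    (ch.half_duplex _ _ i (right_ne_zero_of_mul hω')).resolve_left h']

lemma input_eq_iff (hq : q ∈ inputDistributions X ℓ) {ω ω' : Inputs X × Outputs Y}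
    (hω : jointLaw ch q ω ≠ 0) (hω' : jointLaw ch q ω' ≠ 0) :
    ω.1 = ω'.1 ↔ ∀ i ∈ transmitters m ℓ, ω.1 i = ω'.1 i := by
  refine ⟨fun h i _ => congrFun h i, fun h => funext fun i => ?_⟩
  by_cases hi : i ∈ transmitters m ℓ
  · exact h i hi
  · exact input_eq_of_not_mem hq hω hω' hi

lemma entropy_eq_zero {Ω α : Type*} [Fintype Ω] [Fintype α] {p : Ω → ℝ} (h1 : ∑ ω, p ω = 1)
    {U : Ω → α} (h : ∀ ω ω', p ω ≠ 0 → p ω' ≠ 0 → U ω = U ω') : entropy p U = 0 := by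
  rw [entropy_congr (V := fun _ => ()) fun ω ω' hω hω' => by simp [h ω ω' hω hω']]
  simp [entropy, marginal, h1]

/-- With all transmitters in `T`, the inputs in `T` determine every input on the support, so nothing
crosses the cut. -/
lemma cutInfo_eq_zero (hq : q ∈ inputDistributions X ℓ) {T : Finset (Node m)}
    (hT : transmitters m ℓ ⊆ T) : cutInfo ch q T = 0 := by
  have h : ∀ ω ω', jointLaw ch q ω ≠ 0 → jointLaw ch q ω' ≠ 0 →
      (inputsOf X Y T ω = inputsOf X Y T ω' ↔ ω.1 = ω'.1) := fun ω ω' hω hω' => by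
    rw [inputsOf_eq_iff]
    exact ⟨fun h => (input_eq_iff hq hω hω').2 fun i hi => h i (hT hi),
      fun h i _ => congrFun h i⟩
  rw [cutInfo, condEntropy, condEntropy, entropy_congr h,
    entropy_congr (V := fun ω => (outputsOf X Y T ω, ω.1)), sub_self]
  intro ω ω' hω hω'
  simp only [Prod.mk.injEq, h ω ω' hω hω']

/-- The inputs in `T` are constant and `s` carries the whole input; the rest is symmetry of mutual
information. -/
lemma cutInfo_eq_mutualInfo (hq : q ∈ inputDistributions X ℓ) {s : Node m}
    (hs : transmitters m ℓ = {s}) {T : Finset (Node m)} (hT : s ∉ T) :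
    cutInfo ch q T = mutualInfo (jointLaw ch q) (inputsOf X Y {s}) (outputsOf X Y T) := by
  have hX : ∀ ω ω', jointLaw ch q ω ≠ 0 → jointLaw ch q ω' ≠ 0 →
      (ω.1 = ω'.1 ↔ inputsOf X Y {s} ω = inputsOf X Y {s} ω') := fun ω ω' hω hω' => by
    rw [inputsOf_eq_iff, input_eq_iff hq hω hω', hs]
  have hXT : ∀ ω ω', jointLaw ch q ω ≠ 0 → jointLaw ch q ω' ≠ 0 →
      inputsOf X Y T ω = inputsOf X Y T ω' := fun ω ω' hω hω' => by
    rw [inputsOf_eq_iff]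
    refine fun i hi => input_eq_of_not_mem hq hω hω' ?_
    rw [hs, Finset.mem_singleton]
    rintro rfl
    exact hT hi
  rw [cutInfo, mutualInfo, condEntropy, condEntropy, condEntropy,
    entropy_eq_zero (sum_jointLaw ch hq.1.2) hXT, entropy_congr hX,
    entropy_congr (U := fun ω => (outputsOf X Y T ω, inputsOf X Y T ω)) (V := outputsOf X Y T),
    entropy_congr (U := fun ω => (outputsOf X Y T ω, ω.1))
      (V := fun ω => (inputsOf X Y {s} ω, outputsOf X Y T ω))]
  · ring
  · intro ω ω' hω hω'
    simp only [Prod.mk.injEq, hX ω ω' hω hω', and_comm]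
  · intro ω ω' hω hω'
    simp only [Prod.mk.injEq, hXT ω ω' hω hω', and_true]

/-- Half-duplex operation makes the outputs of the transmitters in the cut constant, so only the
output of `t` counts; and `t` is silent, so its input adds nothing to the conditioning. -/
lemma cutInfo_eq_condMutualInfo (hq : q ∈ inputDistributions X ℓ) {S : Finset (Node m)}
    (hS : S ⊆ transmitters m ℓ) {t : Node m} (ht : t ∉ transmitters m ℓ) :
    cutInfo ch q ((transmitters m ℓ \ S) ∪ {t}) =
      condMutualInfo (jointLaw ch q) (inputsOf X Y S) (outputsOf X Y {t})
        (inputsOf X Y (transmitters m ℓ \ S)) := by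
  set R := transmitters m ℓ with hR
  set T := (R \ S) ∪ {t} with hT
  have hX : ∀ ω ω', jointLaw ch q ω ≠ 0 → jointLaw ch q ω' ≠ 0 →
      (ω.1 = ω'.1 ↔ inputsOf X Y S ω = inputsOf X Y S ω' ∧
        inputsOf X Y (R \ S) ω = inputsOf X Y (R \ S) ω') := fun ω ω' hω hω' => by
    rw [inputsOf_eq_iff, inputsOf_eq_iff, input_eq_iff hq hω hω']
    refine ⟨fun h => ⟨fun i hi => h i (hS hi), fun i hi => h i (Finset.mem_sdiff.1 hi).1⟩,
      fun h i hi => ?_⟩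
    by_cases hiS : i ∈ S
    · exact h.1 i hiS
    · exact h.2 i (Finset.mem_sdiff.2 ⟨hi, hiS⟩)
  have hXT : ∀ ω ω', jointLaw ch q ω ≠ 0 → jointLaw ch q ω' ≠ 0 →
      (inputsOf X Y T ω = inputsOf X Y T ω' ↔
        inputsOf X Y (R \ S) ω = inputsOf X Y (R \ S) ω') := fun ω ω' hω hω' => by
    rw [inputsOf_eq_iff, inputsOf_eq_iff]
    refine ⟨fun h i hi => h i (Finset.mem_union_left _ hi), fun h i hi => ?_⟩
    rcases Finset.mem_union.1 hi with hi | hi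
    · exact h i hi
    · rw [Finset.mem_singleton.1 hi]
      exact input_eq_of_not_mem hq hω hω' ht
  have hYT : ∀ ω ω', jointLaw ch q ω ≠ 0 → jointLaw ch q ω' ≠ 0 →
      (outputsOf X Y T ω = outputsOf X Y T ω' ↔
        outputsOf X Y {t} ω = outputsOf X Y {t} ω') := fun ω ω' hω hω' => by
    rw [outputsOf_eq_iff, outputsOf_eq_iff]
    refine ⟨fun h i hi => h i (Finset.mem_union_right _ hi), fun h i hi => ?_⟩
    rcases Finset.mem_union.1 hi with hi | hi
    · exact output_eq_of_mem hq hω hω' (Finset.mem_sdiff.1 hi).1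
    · exact h i hi
  rw [cutInfo, condMutualInfo, condEntropy, condEntropy, condEntropy, condEntropy,
    entropy_congr hXT,
    entropy_congr (U := fun ω => ω.1)
      (V := fun ω => (inputsOf X Y S ω, inputsOf X Y (R \ S) ω)),
    entropy_congr (U := fun ω => (outputsOf X Y T ω, inputsOf X Y T ω))
      (V := fun ω => (outputsOf X Y {t} ω, inputsOf X Y (R \ S) ω)),
    entropy_congr (U := fun ω => (outputsOf X Y T ω, ω.1))
      (V := fun ω => (inputsOf X Y S ω, (outputsOf X Y {t} ω, inputsOf X Y (R \ S) ω)))]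
  · ring
  · intro ω ω' hω hω'
    simp only [Prod.mk.injEq, hX ω ω' hω hω', hYT ω ω' hω hω']
    tauto
  · intro ω ω' hω hω'
    simp only [Prod.mk.injEq, hXT ω ω' hω hω', hYT ω ω' hω hω']
  · intro ω ω' hω hω'
    simp only [Prod.mk.injEq, hX ω ω' hω hω']

end Cuts

/-! ### From codes to the outer bound at finite block length -/

section Converse

lemma card_phaseAt {n : ℕ} {len : Fin 3 → ℕ} (h : ∑ ℓ, len ℓ = n) (ℓ : Fin 3) :
    (Finset.univ.filter fun k : Fin n => phaseAt len k = ℓ).card = len ℓ := by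
  rw [Fin.sum_univ_three] at h
  -- Here `a` is the first time of the phase.
  have key : ∀ a : ℕ, (∀ k, k < n → (phaseAt len k = ℓ ↔ a ≤ k ∧ k < a + len ℓ)) →
      a + len ℓ ≤ n → (Finset.univ.filter fun k : Fin n => phaseAt len k = ℓ).card = len ℓ := by
    intro a ha han
    have : (Finset.univ.filter fun k : Fin n => phaseAt len k = ℓ).map Fin.valEmbedding =
        Finset.Ico a (a + len ℓ) := by
      ext k
      simp only [Finset.mem_map, Finset.mem_filter, Finset.mem_univ, true_and,
        Fin.valEmbedding_apply, Finset.mem_Ico]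
      constructor
      · rintro ⟨j, hj, rfl⟩
        exact (ha j j.2).1 hj
      · intro hk
        exact ⟨⟨k, by omega⟩, (ha k (by omega)).2 hk, rfl⟩
    rw [← Finset.card_map, this, Nat.card_Ico, Nat.add_sub_cancel_left]
  fin_cases ℓ
  · refine key 0 (fun k hk => ?_) (by simp; omega)
    simp only [phaseAt]
    split_ifs <;> simp <;> omega
  · refine key (len 0) (fun k hk => ?_) (by simp; omega)
    simp only [phaseAt]
    split_ifs <;> simp <;> omega
  · refine key (len 0 + len 1) (fun k hk => ?_) (by simp; omega)
    simp only [phaseAt]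
    split_ifs <;> simp <;> omega

variable {m : ℕ} {X Y : Node m → Type*} [∀ i, Fintype (X i)] [∀ i, Fintype (Y i)]
  {n Ma Mb : ℕ}

/-- The channel inputs at time `k`, given the messages and the outputs before `k`. -/
def Code.inputOfPast (c : Code X Y n Ma Mb) (wa : Fin Ma) (wb : Fin Mb) (k : Fin n)
    (s : Fin k → Outputs Y) : Inputs X := fun i =>
  if i ∈ transmitters m (phaseAt c.len k) then
    some (c.enc i k (messages wa wb i) fun j => s j i)
  else none

lemma Code.prob_eq_feedbackLaw (c : Code X Y n Ma Mb) (ch : Channel X Y) (wa : Fin Ma)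
    (wb : Fin Mb) (y : Fin n → Outputs Y) :
    c.prob ch wa wb y = feedbackLaw ch.law c.inputOfPast (wa, wb, y) := by
  simp only [feedbackLaw, Fintype.card_fin]
  rfl

lemma feedbackLaw_swap {A B M N : Type*} [Fintype A] [Fintype B] [Fintype M] [Fintype N]
    (W : A → B → ℝ) (inp : M → N → ∀ k : Fin n, (Fin k → B) → A) (a : M) (b : N)
    (y : Fin n → B) :
    feedbackLaw W (fun b a => inp a b) (b, a, y) = feedbackLaw W inp (a, b, y) := by
  simp only [feedbackLaw, mul_comm (Fintype.card N : ℝ)⁻¹]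

/-- The mass function of the inputs at time `k`. -/
def Code.inputLaw (c : Code X Y n Ma Mb) (ch : Channel X Y) (k : Fin n) : Inputs X → ℝ :=
  marginal (feedbackLaw ch.law c.inputOfPast)
    fun ω => c.inputOfPast ω.1 ω.2.1 k (past ω.2.2 k)

lemma Code.inputLaw_eq_swap (c : Code X Y n Ma Mb) (ch : Channel X Y) (k : Fin n)
    (x : Inputs X) : c.inputLaw ch k x =
      marginal (feedbackLaw ch.law fun wb wa => c.inputOfPast wa wb)
        (fun ω => c.inputOfPast ω.2.1 ω.1 k (past ω.2.2 k)) x := by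
  simp only [inputLaw, marginal, Finset.sum_filter, Fintype.sum_prod_type, feedbackLaw_swap]
  exact Finset.sum_comm

/-- The time average of the input laws over a phase keeps the support condition, as the code lets
exactly the transmitters of that phase send. -/
lemma Code.exists_average [∀ i, Nonempty (X i)] [NeZero Ma] [NeZero Mb] (c : Code X Y n Ma Mb)
    (ch : Channel X Y) (ℓ : Fin 3) : ∃ q ∈ inputDistributions X ℓ,
      ∀ x, (c.len ℓ : ℝ) * q x =
        ∑ k ∈ Finset.univ.filter (fun k : Fin n => phaseAt c.len k = ℓ), c.inputLaw ch k x := by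
  have hcard := card_phaseAt c.len_sum ℓ
  by_cases h0 : c.len ℓ = 0
  -- An empty phase imposes no constraint beyond admissibility, so any admissible point mass works.
  · refine ⟨Pi.single (fun i => if i ∈ transmitters m ℓ then some (Classical.arbitrary _)
      else none) 1, ⟨single_mem_stdSimplex ℝ _, ?_⟩, ?_⟩
    · intro x hx i
      by_cases h : x = fun i => if i ∈ transmitters m ℓ then some (Classical.arbitrary _)
          else none
      · rw [h]
        by_cases hi : i ∈ transmitters m ℓ <;> simp [hi]
      · exact absurd (Pi.single_eq_of_ne h _) hx
    · intro x
      rw [h0, Finset.card_eq_zero] at hcard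
      rw [hcard, h0]
      simp
  have h0' : (c.len ℓ : ℝ) ≠ 0 := Nat.cast_ne_zero.2 h0
  have hP := feedbackLaw_nonneg (fun x v => (ch.law_mem x).1 v) c.inputOfPast
  refine ⟨fun x => (c.len ℓ : ℝ)⁻¹ *
      ∑ k ∈ Finset.univ.filter (fun k : Fin n => phaseAt c.len k = ℓ), c.inputLaw ch k x,
    ⟨⟨fun x => mul_nonneg (by positivity)
      (Finset.sum_nonneg fun k _ => marginal_nonneg hP _ _), ?_⟩, ?_⟩,
    fun x => mul_inv_cancel_left₀ h0' _⟩
  · rw [← Finset.mul_sum, Finset.sum_comm]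
    have h1 : ∀ k, ∑ x, c.inputLaw ch k x = 1 := by
      intro k
      have := sum_marginal_mul (feedbackLaw ch.law c.inputOfPast)
        (fun ω => c.inputOfPast ω.1 ω.2.1 k (past ω.2.2 k)) fun _ => 1
      simp only [mul_one] at this
      exact this.trans (sum_feedbackLaw (fun x => (ch.law_mem x).2) _)
    simp only [h1, Finset.sum_const, hcard, nsmul_eq_mul, mul_one]
    exact inv_mul_cancel₀ h0'
  · intro x hx i
    obtain ⟨k, hk, hkx⟩ := Finset.exists_ne_zero_of_sum_ne_zero (right_ne_zero_of_mul hx)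
    obtain ⟨ω, hω, -⟩ := Finset.exists_ne_zero_of_sum_ne_zero hkx
    have hωx : c.inputOfPast ω.1 ω.2.1 k (past ω.2.2 k) = x := by simpa using hω
    rw [← hωx, ← (Finset.mem_filter.1 hk).2]
    simp [inputOfPast]

/-- The cut-set converse for a code of finite block length. -/
lemma Code.exists_cutInfo_bound [∀ i, Nonempty (X i)] [NeZero Ma] [NeZero Mb]
    (c : Code X Y n Ma Mb) (ch : Channel X Y) :
    ∃ q : Fin 3 → Inputs X → ℝ, (∀ ℓ, q ℓ ∈ inputDistributions X ℓ) ∧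
      (∀ T : Finset (Node m), Node.b ∈ T → Node.a ∉ T →
        (1 - c.errorAB ch) * Real.log Ma - Real.log 2 ≤
          ∑ ℓ, (c.len ℓ : ℝ) * (cutInfo ch (q ℓ) T * Real.log 2)) ∧
      (∀ T : Finset (Node m), Node.a ∈ T → Node.b ∉ T →
        (1 - c.errorBA ch) * Real.log Mb - Real.log 2 ≤
          ∑ ℓ, (c.len ℓ : ℝ) * (cutInfo ch (q ℓ) T * Real.log 2)) := by
  choose q hq hlen using c.exists_average ch
  have hW0 : ∀ x v, 0 ≤ ch.law x v := fun x v => (ch.law_mem x).1 v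
  have hW1 : ∀ x, ∑ v, ch.law x v = 1 := fun x => (ch.law_mem x).2
  refine ⟨q, hq, fun T hb ha => ?_, fun T ha hb => ?_⟩
  · have := log_card_le hW0 hW1 c.inputOfPast (fun (x : Inputs X) (i : T) => x i)
      (fun (y : Outputs Y) (i : T) => y i)
      (fun wb k s i => if i.1 ∈ transmitters m (phaseAt c.len k) then
        some (c.enc i k (messages (0 : Fin Ma) wb i.1) fun j => s j i) else none)
      (by
        rintro wa wb k s
        funext ⟨i, hi⟩
        cases i with
        | a => exact absurd hi ha
        | b => rfl
        | relay r => rfl)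
      (fun z wb => c.decB (fun k => z k ⟨Node.b, hb⟩) wb) (fun k => phaseAt c.len k)
      (fun ℓ => (c.len ℓ : ℝ)) q (fun ℓ x => (hq ℓ).1.1 x) hlen
    rw [Fintype.card_fin] at this
    simp only [Fintype.sum_prod_type, ← Code.prob_eq_feedbackLaw] at this
    exact this
  · have := log_card_le hW0 hW1 (fun wb wa => c.inputOfPast wa wb)
      (fun (x : Inputs X) (i : T) => x i) (fun (y : Outputs Y) (i : T) => y i)
      (fun wa k s i => if i.1 ∈ transmitters m (phaseAt c.len k) then
        some (c.enc i k (messages wa (0 : Fin Mb) i.1) fun j => s j i) else none)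
      (by
        rintro wb wa k s
        funext ⟨i, hi⟩
        cases i with
        | a => rfl
        | b => exact absurd hi hb
        | relay r => rfl)
      (fun z wa => c.decA (fun k => z k ⟨Node.a, ha⟩) wa) (fun k => phaseAt c.len k)
      (fun ℓ => (c.len ℓ : ℝ)) q (fun ℓ x => (hq ℓ).1.1 x)
      (fun ℓ x => by simp only [hlen, c.inputLaw_eq_swap])
    rw [Fintype.card_fin] at this
    simp only [Fintype.sum_prod_type, feedbackLaw_swap, ← Code.prob_eq_feedbackLaw] at this
    rw [Finset.sum_comm] at this
    exact this

lemma a_notMem_relays : Node.a ∉ relays m := by simp [relays]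

lemma b_notMem_relays : Node.b ∉ relays m := by simp [relays]

/-- A code of positive block length satisfies the outer bound up to an error that vanishes. -/
lemma Code.mem_outerRegion [∀ i, Nonempty (X i)] [NeZero Ma] [NeZero Mb]
    (c : Code X Y n Ma Mb) (ch : Channel X Y) (hn : 0 < n) :
    (((1 - c.errorAB ch) * Real.logb 2 Ma - 1) / n,
      ((1 - c.errorBA ch) * Real.logb 2 Mb - 1) / n) ∈
        outerRegion ch fun ℓ => (c.len ℓ : ℝ) / n := by
  have h2 : 0 < Real.log 2 := Real.log_pos one_lt_two
  have hn' : (0 : ℝ) < n := Nat.cast_pos.2 hn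
  obtain ⟨q, hq, hA, hB⟩ := c.exists_cutInfo_bound ch
  -- Conversion from nats to bits and from totals to rates per channel use.
  have key : ∀ {e : ℝ} {M : ℕ} {i₁ i₂ i₃ : ℝ},
      (1 - e) * Real.log M - Real.log 2 ≤ c.len 0 * (i₁ * Real.log 2) +
        c.len 1 * (i₂ * Real.log 2) + c.len 2 * (i₃ * Real.log 2) →
      ((1 - e) * Real.logb 2 M - 1) / n ≤ c.len 0 / n * i₁ + c.len 1 / n * i₂ +
        c.len 2 / n * i₃ := by
    intro e M i₁ i₂ i₃ h
    rw [Real.logb, div_le_iff₀ hn', ← mul_le_mul_iff_left₀ h2]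
    refine le_trans (le_of_eq ?_) (h.trans (le_of_eq ?_))
    · field_simp
    · field_simp
  refine ⟨q, hq, fun S hS => ⟨?_, ?_⟩⟩
  · have h := hA ((relays m \ S) ∪ {Node.b}) (by simp)
      (by simp [a_notMem_relays])
    rw [Fin.sum_univ_three] at h
    have h := key h
    rw [cutInfo_eq_mutualInfo (hq 0) (s := Node.a) rfl (by simp [a_notMem_relays]),
      cutInfo_eq_zero (hq 1) (show ({Node.b} : Finset (Node m)) ⊆ _ from
        Finset.subset_union_right),
      show relays m = transmitters m 2 from rfl,
      cutInfo_eq_condMutualInfo (hq 2) hS b_notMem_relays] at h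
    rw [mul_zero, add_zero] at h
    exact h
  · have h := hB ((relays m \ S) ∪ {Node.a}) (by simp)
      (by simp [b_notMem_relays])
    rw [Fin.sum_univ_three] at h
    have h := key h
    rw [cutInfo_eq_mutualInfo (hq 1) (s := Node.b) rfl (by simp [b_notMem_relays]),
      cutInfo_eq_zero (hq 0) (show ({Node.a} : Finset (Node m)) ⊆ _ from
        Finset.subset_union_right),
      show relays m = transmitters m 2 from rfl,
      cutInfo_eq_condMutualInfo (hq 2) hS a_notMem_relays] at h
    rw [mul_zero, zero_add] at h
    exact h

end Converse

/-! ### Compactness and the limit of long blocks -/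

section Limit

open Filter Topology

variable {m : ℕ} {X Y : Node m → Type*} [∀ i, Fintype (X i)] [∀ i, Fintype (Y i)]

lemma isCompact_inputDistributions (ℓ : Fin 3) :
    IsCompact (inputDistributions X ℓ) := by
  have h : inputDistributions X ℓ = stdSimplex ℝ (Inputs X) ∩
      ⋂ x : Inputs X, {q | q x ≠ 0 → ∀ i, i ∈ transmitters m ℓ ↔ x i ≠ none} := by
    ext q
    simp [inputDistributions]
  rw [h]
  refine (isCompact_stdSimplex ℝ (Inputs X)).inter_right (isClosed_iInter fun x => ?_)
  -- For a fixed `x` the condition is either void or the closed condition `q x = 0`.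
  by_cases h : ∀ i, i ∈ transmitters m ℓ ↔ x i ≠ none
  · convert isClosed_univ
    exact Set.eq_univ_of_forall fun q _ => h
  · convert isClosed_eq (f := fun q : Inputs X → ℝ => q x) (g := fun _ => 0)
      (continuous_apply x) continuous_const
    exact ⟨fun hq => by_contra fun hx => h (hq hx), fun hq hx => absurd hq hx⟩

lemma continuous_entropy_jointLaw (ch : Channel X Y) {α : Type*} [Fintype α]
    (U : Inputs X × Outputs Y → α) :
    Continuous fun q : Inputs X → ℝ => entropy (jointLaw ch q) U := by
  unfold entropy marginal jointLaw
  refine Continuous.div_const (continuous_finsetSum _ fun u _ =>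
    Real.continuous_negMulLog.comp (continuous_finsetSum _ fun ω _ => ?_)) _
  fun_prop

lemma continuous_mutualInfo_jointLaw (ch : Channel X Y) {α β : Type*} [Fintype α] [Fintype β]
    (U : Inputs X × Outputs Y → α) (V : Inputs X × Outputs Y → β) :
    Continuous fun q : Inputs X → ℝ => mutualInfo (jointLaw ch q) U V := by
  unfold mutualInfo condEntropy
  exact (continuous_entropy_jointLaw ch _).sub
    ((continuous_entropy_jointLaw ch _).sub (continuous_entropy_jointLaw ch _))

lemma continuous_condMutualInfo_jointLaw (ch : Channel X Y) {α β γ : Type*} [Fintype α]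
    [Fintype β] [Fintype γ] (U : Inputs X × Outputs Y → α) (V : Inputs X × Outputs Y → β)
    (Z : Inputs X × Outputs Y → γ) :
    Continuous fun q : Inputs X → ℝ => condMutualInfo (jointLaw ch q) U V Z := by
  unfold condMutualInfo condEntropy
  exact ((continuous_entropy_jointLaw ch _).sub (continuous_entropy_jointLaw ch _)).sub
    ((continuous_entropy_jointLaw ch _).sub (continuous_entropy_jointLaw ch _))

/-- The outer region is closed, also jointly with the phase durations. -/
lemma isClosed_setOf_mem_outerRegion (ch : Channel X Y) :
    IsClosed {z : (ℝ × ℝ) × (Fin 3 → ℝ) | z.1 ∈ outerRegion ch z.2} := by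
  have hK : IsCompact (Set.univ.pi fun ℓ => inputDistributions X ℓ) :=
    isCompact_univ_pi fun ℓ => isCompact_inputDistributions ℓ
  set K := Set.univ.pi fun ℓ => inputDistributions X ℓ
  have : CompactSpace K := isCompact_iff_compactSpace.1 hK
  have hc : ∀ ℓ : Fin 3, Continuous fun w : ((ℝ × ℝ) × (Fin 3 → ℝ)) × K => w.2.1 ℓ :=
    fun ℓ => (continuous_apply ℓ).comp (continuous_subtype_val.comp continuous_snd)
  have hΔ : ∀ ℓ : Fin 3, Continuous fun w : ((ℝ × ℝ) × (Fin 3 → ℝ)) × K => w.1.2 ℓ :=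
    fun ℓ => by fun_prop
  have hcl : IsClosed {w : ((ℝ × ℝ) × (Fin 3 → ℝ)) × K | ∀ S ⊆ relays m,
      w.1.1.1 ≤
        w.1.2 0 * mutualInfo (jointLaw ch (w.2.1 0)) (inputsOf X Y {Node.a})
            (outputsOf X Y ((relays m \ S) ∪ {Node.b})) +
        w.1.2 2 * condMutualInfo (jointLaw ch (w.2.1 2)) (inputsOf X Y S)
            (outputsOf X Y {Node.b}) (inputsOf X Y (relays m \ S)) ∧
      w.1.1.2 ≤
        w.1.2 1 * mutualInfo (jointLaw ch (w.2.1 1)) (inputsOf X Y {Node.b})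
            (outputsOf X Y ((relays m \ S) ∪ {Node.a})) +
        w.1.2 2 * condMutualInfo (jointLaw ch (w.2.1 2)) (inputsOf X Y S)
            (outputsOf X Y {Node.a}) (inputsOf X Y (relays m \ S))} := by
    simp only [Set.ofPred_forall, Set.ofPred_and]
    refine isClosed_iInter fun S => isClosed_iInter fun _ => IsClosed.inter ?_ ?_
    · exact isClosed_le (by fun_prop)
        (((hΔ 0).mul ((continuous_mutualInfo_jointLaw ch _ _).comp (hc 0))).add
          ((hΔ 2).mul ((continuous_condMutualInfo_jointLaw ch _ _ _).comp (hc 2))))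
    · exact isClosed_le (by fun_prop)
        (((hΔ 1).mul ((continuous_mutualInfo_jointLaw ch _ _).comp (hc 1))).add
          ((hΔ 2).mul ((continuous_condMutualInfo_jointLaw ch _ _ _).comp (hc 2))))
  -- The existential over input distributions is a projection along the compact space `K`, hence
  -- preserves closedness.
  convert isClosedMap_fst_of_compactSpace _ hcl
  ext z
  constructor
  · rintro ⟨q, hq, h⟩
    exact ⟨(z, ⟨q, fun ℓ _ => hq ℓ⟩), h, rfl⟩
  · rintro ⟨⟨z', q, hq⟩, h, rfl⟩
    exact ⟨q, fun ℓ => hq ℓ trivial, h⟩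

lemma one_le_rpow_mul {R : ℝ} (hR : 0 ≤ R) (n : ℕ) : (1 : ℝ) ≤ 2 ^ ((n : ℝ) * R) :=
  Real.one_le_rpow one_le_two (by positivity)

lemma numMessages_ne_zero {R : ℝ} (hR : 0 ≤ R) (n : ℕ) : numMessages n R ≠ 0 :=
  (Nat.floor_pos.2 (one_le_rpow_mul hR n)).ne'

lemma tendsto_logb_numMessages {R : ℝ} (hR : 0 ≤ R) :
    Tendsto (fun n : ℕ => Real.logb 2 (numMessages n R) / n) atTop (𝓝 R) := by
  have hpos : ∀ n : ℕ, (0 : ℝ) < numMessages n R := fun n =>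
    Nat.cast_pos.2 (Nat.pos_of_ne_zero (numMessages_ne_zero hR n))
  -- Rounding down a number that is at least 1 loses less than a factor 2, that is, one bit per
  -- block.
  have hlow : Tendsto (fun n : ℕ => R - 1 / (n : ℝ)) atTop (𝓝 R) := by
    simpa using tendsto_one_div_atTop_nhds_zero_nat.const_sub R
  refine tendsto_of_tendsto_of_tendsto_of_le_of_le' hlow tendsto_const_nhds ?_ ?_
  · filter_upwards [eventually_gt_atTop 0] with n hn
    have hn' : (0 : ℝ) < n := Nat.cast_pos.2 hn
    rw [le_div_iff₀ hn', Real.le_logb_iff_rpow_le one_lt_two (hpos n)]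
    have h1 : (R - 1 / (n : ℝ)) * n = n * R - 1 := by field_simp
    rw [h1, Real.rpow_sub_one two_ne_zero]
    have h2 := one_le_rpow_mul hR n
    have h3 : (2 : ℝ) ^ ((n : ℝ) * R) < numMessages n R + 1 := Nat.lt_floor_add_one _
    have h4 : (1 : ℝ) ≤ numMessages n R := by
      exact_mod_cast Nat.pos_of_ne_zero (numMessages_ne_zero hR n)
    linarith
  · filter_upwards [eventually_gt_atTop 0] with n hn
    have hn' : (0 : ℝ) < n := Nat.cast_pos.2 hn
    rw [div_le_iff₀ hn', Real.logb_le_iff_le_rpow one_lt_two (hpos n), mul_comm R]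
    exact Nat.floor_le (by positivity)

lemma tendsto_converse_rate {R : ℝ} (hR : 0 ≤ R) {e : ℕ → ℝ} (he : Tendsto e atTop (𝓝 0)) :
    Tendsto (fun n : ℕ => ((1 - e n) * Real.logb 2 (numMessages n R) - 1) / n) atTop (𝓝 R) := by
  have h := ((he.const_sub 1).mul (tendsto_logb_numMessages hR)).sub
    tendsto_one_div_atTop_nhds_zero_nat
  simp only [sub_zero, one_mul] at h
  refine h.congr fun n => ?_
  ring

/-- The finite-length bounds hold with the actual durations `len ℓ / n`, which only converge to `Δ`.
This is why closedness is needed jointly in rates and durations. -/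
lemma Achievable.mem_outerRegion [∀ i, Nonempty (X i)] {ch : Channel X Y} {Δ : Fin 3 → ℝ}
    {Ra Rb : ℝ} (h : Achievable ch Δ Ra Rb) : (Ra, Rb) ∈ outerRegion ch Δ := by
  obtain ⟨hRa, hRb, c, hlen, hAB, hBA⟩ := h
  have hlim := ((tendsto_converse_rate hRa hAB).prodMk_nhds
    (tendsto_converse_rate hRb hBA)).prodMk_nhds (tendsto_pi_nhds.2 hlen)
  refine (isClosed_setOf_mem_outerRegion ch).mem_of_tendsto hlim ?_
  filter_upwards [eventually_gt_atTop 0] with n hn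
  have : NeZero (numMessages n Ra) := ⟨numMessages_ne_zero hRa n⟩
  have : NeZero (numMessages n Rb) := ⟨numMessages_ne_zero hRb n⟩
  exact (c n).mem_outerRegion ch hn

end Limit

end

end BidirectionalRelay


theorem mainTheorem7 (m : ℕ) (X Y : BidirectionalRelay.Node m → Type*)
    [∀ i, Fintype (X i)] [∀ i, Nonempty (X i)] [∀ i, Fintype (Y i)]
    (ch : BidirectionalRelay.Channel X Y)
    (Δ : Fin 3 → ℝ) (hΔ : ∀ ℓ, 0 ≤ Δ ℓ) (hΔsum : ∑ ℓ, Δ ℓ = 1) :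
    BidirectionalRelay.capacityRegion ch Δ ⊆ BidirectionalRelay.outerRegion ch Δ :=
  closure_minimal (fun _ h => h.mem_outerRegion)
    ((BidirectionalRelay.isClosed_setOf_mem_outerRegion ch).preimage
      (continuous_id.prodMk continuous_const))
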